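/- Let $X$ be a real Banach space with dual $X^*$, and let $J:X\to 2^{X^*}$, $J(x)=\{x^*\in X^*:\langle x,x^*\rangle=\|x\|^2=\|x^*\|^2\}$, be its normalized duality mapping. Suppose that at least one of the following holds: (i) $X$ is reflexive and $J$ is weakly continuous, i.e. $J$ is single-valued and, whenever a sequence $x_n$ converges weakly to $x$ in $X$, $J(x_n)$ converges weak$^*$ to $J(x)$ in $X^*$; (ii) $X$ is uniformly smooth, i.e. $\lim_{t\to0}\frac{\|x+ty\|-\|x\|}{t}$ exists uniformly for $x,y$ in the unit sphere of $X$. Let $C\subset X$ be nonempty, closed and convex, let $T:C\to C$ be nonexpansive ($\|Tx-Ty\|\le\|x-y\|$ for all $x,y\in C$) with fixed point set $F=\{x\in C:Tx=x\}\neq\emptyset$, and let $\Phi:C\to C$ be a $\rho$-contraction, i.e. $\|\Phi(x)-\Phi(y)\|\le\rho\|x-y\|$ for all $x,y\in C$, where $0\le\rho<1$. Then: (a) for every $t\in(0,1)$ there is a unique $x_t\in C$ with $$x_t=T\bigl(t\Phi(x_t)+(1-t)x_t\bigr);$$ (b) $J$ is single-valued, there is a unique $q\in F$ such that $$\langle(\Phi-I)q,\,J(x-q)\rangle\le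 0\qquad\text{for all }x\in F,$$ and $x_t$ converges strongly (in norm) to $q$ as $t\to0^+$. -/

import Mathlib

open Set Filter Topology

/-- The normalized duality mapping `J : X → 2^{X*}`,
`J x = {x* | ⟨x, x*⟩ = ‖x‖² = ‖x*‖²}`. -/
def normalizedDualityMap (X : Type*) [NormedAddCommGroup X] [NormedSpace ℝ X] (x : X) :
    Set (StrongDual ℝ X) :=
  {f | f x = ‖x‖ ^ 2 ∧ ‖f‖ ^ 2 = ‖x‖ ^ 2}

/-- `X` is uniformly smooth: the limit of `(‖x + t y‖ - ‖x‖) / t` as `t → 0` (`t ≠ 0`)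
exists uniformly for `x`, `y` in the unit sphere. -/
def IsUniformlySmoothSpace (X : Type*) [NormedAddCommGroup X] [NormedSpace ℝ X] : Prop :=
  ∃ L : X × X → ℝ,
    TendstoUniformlyOn (fun (t : ℝ) (p : X × X) => (‖p.1 + t • p.2‖ - ‖p.1‖) / t) L (𝓝[≠] 0)
      (Metric.sphere (0 : X) 1 ×ˢ Metric.sphere (0 : X) 1)

/-- `X` is reflexive: the canonical embedding into the bidual is onto. -/
def IsReflexiveSpace (X : Type*) [NormedAddCommGroup X] [NormedSpace ℝ X] : Prop :=
  Function.Surjective (NormedSpace.inclusionInDoubleDual ℝ X)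

/-- The normalized duality mapping is weakly (sequentially) continuous: it is single-valued,
and weak-to-weak* sequentially continuous. -/
def HasWeaklyContinuousDualityMap (X : Type*) [NormedAddCommGroup X] [NormedSpace ℝ X] : Prop :=
  ∃ J : X → StrongDual ℝ X, (∀ x, normalizedDualityMap X x = {J x}) ∧
    ∀ (u : ℕ → X) (x : X),
      Tendsto (fun n => toWeakSpace ℝ X (u n)) atTop (𝓝 (toWeakSpace ℝ X x)) →
      Tendsto (fun n => StrongDual.toWeakDual (J (u n))) atTop (𝓝 (StrongDual.toWeakDual (J x)))

/-- `q ∈ F` solves the variational inequality `⟨(Φ - I) q, J (x - q)⟩ ≤ 0` for all `x ∈ F`. -/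
def SolvesVI {X : Type*} [NormedAddCommGroup X] [NormedSpace ℝ X] (J : X → StrongDual ℝ X)
    (Φ : X → X) (F : Set X) (q : X) : Prop :=
  q ∈ F ∧ ∀ x ∈ F, J (x - q) (Φ q - q) ≤ 0

section Preliminaries

theorem existsUnique_fixedPoint_of_contraction_on {X : Type*}
    [NormedAddCommGroup X] [CompleteSpace X] {S : Set X}
    (hS : IsClosed S) (hne : S.Nonempty) {g : X → X} (hg : MapsTo g S S) {k : ℝ} (hk : k < 1)
    (hk0 : 0 ≤ k) (hcontr : ∀ x ∈ S, ∀ y ∈ S, ‖g x - g y‖ ≤ k * ‖x - y‖) :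
    ∃! y : X, y ∈ S ∧ y = g y := by
  obtain ⟨a, ha⟩ := hne
  have hc : ContractingWith ⟨k, hk0⟩ (hg.restrict g S S) := by
    refine ⟨by exact_mod_cast hk, LipschitzWith.of_dist_le_mul fun x y => ?_⟩
    change dist (g x) (g y) ≤ k * dist (x : X) y
    simpa only [dist_eq_norm] using hcontr x x.2 y y.2
  obtain ⟨y, hyS, hy, -⟩ := hc.exists_fixedPoint' hS.isComplete hg ha (edist_ne_top _ _)
  refine ⟨y, ⟨hyS, hy.symm⟩, fun z hz => ?_⟩
  have h := hcontr z hz.1 y hyS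
  rw [← hz.2, hy.eq] at h
  have h0 : ‖z - y‖ = 0 := by nlinarith [norm_nonneg (z - y)]
  exact sub_eq_zero.1 (norm_eq_zero.1 h0)

variable {X : Type*} [NormedAddCommGroup X] [NormedSpace ℝ X]

theorem Ultrafilter.exists_tendsto_of_abs_le {ι : Type*} (U : Ultrafilter ι) {g : ι → ℝ} {M : ℝ}
    (h : ∀ᶠ i in (U : Filter ι), |g i| ≤ M) : ∃ c, Tendsto g U (𝓝 c) := by
  obtain ⟨c, -, hc⟩ := (isCompact_Icc (a := -M) (b := M)).ultrafilter_le_nhds' (U.map g)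
    (Filter.mem_map.2 (h.mono fun i hi => abs_le.1 hi))
  exact ⟨c, hc⟩

theorem IsReflexiveSpace.exists_weak_ultralimit (hr : IsReflexiveSpace X) {ι : Type*}
    (U : Ultrafilter ι) {u : ι → X} {M : ℝ} (hu : ∀ i, ‖u i‖ ≤ M) :
    ∃ x : X, ∀ f : StrongDual ℝ X, Tendsto (fun i => f (u i)) U (𝓝 (f x)) := by
  have hb : ∀ (f : StrongDual ℝ X) i, |f (u i)| ≤ M * ‖f‖ := fun f i => by
    have := f.le_opNorm (u i)
    rw [Real.norm_eq_abs] at this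
    nlinarith [hu i, norm_nonneg f]
  choose G hG using fun f : StrongDual ℝ X =>
    U.exists_tendsto_of_abs_le (Eventually.of_forall (hb f))
  let G' : StrongDual ℝ X →ₗ[ℝ] ℝ :=
    { toFun := G
      map_add' := fun f g => tendsto_nhds_unique (hG (f + g)) ((hG f).add (hG g))
      map_smul' := fun c f => tendsto_nhds_unique (hG (c • f)) ((hG f).const_mul c) }
  obtain ⟨x, hx⟩ := hr (G'.mkContinuous M fun f =>
    le_of_tendsto (hG f).norm (Eventually.of_forall (hb f)))
  refine ⟨x, fun f => ?_⟩
  have : f x = G f := by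
    rw [← NormedSpace.dual_def ℝ X x f, hx]; rfl
  rw [this]
  exact hG f

theorem Convex.mem_of_weak_tendsto {C : Set X} (hc : Convex ℝ C) (hC : IsClosed C) {ι : Type*}
    {l : Filter ι} [l.NeBot] {u : ι → X} {x : X} (hu : ∀ᶠ i in l, u i ∈ C)
    (h : ∀ f : StrongDual ℝ X, Tendsto (fun i => f (u i)) l (𝓝 (f x))) : x ∈ C := by
  by_contra hx
  obtain ⟨f, r, hf, hr⟩ := geometric_hahn_banach_closed_point hc hC hx
  exact hr.not_ge (le_of_tendsto (h f) (hu.mono fun i hi => (hf _ hi).le))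

/-- In a reflexive space, a nonempty chain of nonempty bounded closed convex sets has nonempty
intersection. -/
theorem IsReflexiveSpace.nonempty_sInter_of_isChain (hr : IsReflexiveSpace X) {c : Set (Set X)}
    (hc : IsChain (· ⊆ ·) c) (hne : c.Nonempty) {M : ℝ}
    (h : ∀ A ∈ c, A.Nonempty ∧ IsClosed A ∧ Convex ℝ A ∧ ∀ x ∈ A, ‖x‖ ≤ M) :
    (⋂₀ c).Nonempty := by
  choose u hu using fun A : c => (h A A.2).1
  have : Nonempty c := hne.to_subtype
  have hdir : IsDirected cᵒᵈ (· ≤ ·) := ⟨fun A B => by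
    rcases hc.total (OrderDual.ofDual A).2 (OrderDual.ofDual B).2 with hAB | hAB
    · exact ⟨A, le_refl A, hAB⟩
    · exact ⟨B, hAB, le_refl B⟩⟩
  obtain ⟨x, hx⟩ := hr.exists_weak_ultralimit (Ultrafilter.of (atTop : Filter cᵒᵈ))
    (u := fun A => u (OrderDual.ofDual A)) (M := M) fun A => (h _ A.ofDual.2).2.2.2 _ (hu A.ofDual)
  refine ⟨x, fun A hA => (h A hA).2.2.1.mem_of_weak_tendsto (h A hA).2.1
    (u := fun A => u (OrderDual.ofDual A)) ?_ hx⟩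
  refine Ultrafilter.of_le _
    ((eventually_ge_atTop (OrderDual.toDual (⟨A, hA⟩ : c))).mono fun B hB => ?_)
  exact hB (hu B.ofDual)

/-- Bounded sequences in a reflexive space have weakly convergent subsequences. -/
theorem IsReflexiveSpace.exists_weak_tendsto_subseq (hr : IsReflexiveSpace X) {u : ℕ → X} {M : ℝ}
    (hu : ∀ n, ‖u n‖ ≤ M) :
    ∃ (x : X) (φ : ℕ → ℕ), StrictMono φ ∧
      ∀ f : StrongDual ℝ X, Tendsto (fun n => f (u (φ n))) atTop (𝓝 (f x)) := by
  let Y : Submodule ℝ X := (Submodule.span ℝ (range u)).topologicalClosure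
  have hYsep : TopologicalSpace.IsSeparable (Y : Set X) := by
    simpa [Y] using ((countable_range u).isSeparable.span (R := ℝ)).closure
  obtain ⟨D, hDc, hD⟩ := hYsep
  obtain ⟨d, hd⟩ : ∃ d : ℕ → X, insert 0 D = range d :=
    (hDc.insert 0).exists_eq_range (insert_nonempty _ _)
  choose f hf1 hf using fun k => exists_dual_vector'' ℝ (d k)
  have hsepar : ∀ y ∈ Y, (∀ k, f k y = 0) → y = 0 := by
    intro y hy h0
    by_contra hne
    have hpos : 0 < ‖y‖ / 2 := by have := norm_pos_iff.2 hne; linarith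
    obtain ⟨z, hz, hyz⟩ := Metric.mem_closure_iff.1 (hD hy) _ hpos
    obtain ⟨k, rfl⟩ : z ∈ range d := hd ▸ mem_insert_of_mem _ hz
    have h1 : ‖d k‖ ≤ ‖y - d k‖ := by
      have h2 := (f k).le_of_opNorm_le (hf1 k) (y - d k)
      rw [map_sub, h0, hf k] at h2
      simpa using h2
    rw [dist_eq_norm] at hyz
    have := norm_sub_norm_le y (d k)
    linarith
  have hM : 0 ≤ M := (norm_nonneg _).trans (hu 0)
  obtain ⟨a, -, φ, hφ, ha⟩ := (isCompact_univ_pi (ι := ℕ) (s := fun _ => Icc (-M) M)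
    fun _ => isCompact_Icc).tendsto_subseq (x := fun n k => f k (u n)) fun n k _ => by
      have h2 := (f k).le_of_opNorm_le (hf1 k) (u n)
      exact abs_le.1 (by simpa using h2.trans (by simpa using hu n))
  have hlim : ∀ U : Ultrafilter ℕ, ↑U ≤ (atTop : Filter ℕ) → ∃ x ∈ Y, (∀ k, f k x = a k) ∧
      ∀ g : StrongDual ℝ X, Tendsto (fun n => g (u (φ n))) U (𝓝 (g x)) := by
    intro U hU
    obtain ⟨x, hx⟩ := hr.exists_weak_ultralimit U fun n => hu (φ n)
    refine ⟨x, ?_, fun k => ?_, hx⟩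
    · refine Y.convex.mem_of_weak_tendsto (Submodule.isClosed_topologicalClosure _)
        (Eventually.of_forall fun n => ?_) hx
      exact Submodule.le_topologicalClosure _ (Submodule.subset_span (mem_range_self _))
    · exact tendsto_nhds_unique (hx (f k)) ((tendsto_pi_nhds.1 ha k).mono_left hU)
  obtain ⟨x, hxY, hxa, -⟩ := hlim (Ultrafilter.of atTop) (Ultrafilter.of_le _)
  refine ⟨x, φ, hφ, fun g => (tendsto_iff_ultrafilter _ _ _).2 fun U hU => ?_⟩
  obtain ⟨z, hzY, hza, hz⟩ := hlim U hU
  have : z - x = 0 := hsepar _ (Y.sub_mem hzY hxY) fun k => by rw [map_sub, hza, hxa, sub_self]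
  rw [← sub_eq_zero.1 this]
  exact hz g

end Preliminaries

section DualityMap

variable {X : Type*} [NormedAddCommGroup X] [NormedSpace ℝ X] {J : X → StrongDual ℝ X}

theorem normalizedDualityMap_nonempty (x : X) : (normalizedDualityMap X x).Nonempty := by
  rcases eq_or_ne x 0 with rfl | hx
  · exact ⟨0, by simp [normalizedDualityMap]⟩
  · obtain ⟨g, hg, hgx⟩ := exists_dual_vector ℝ x (norm_ne_zero_iff.2 hx)
    refine ⟨‖x‖ • g, ?_, ?_⟩
    · simp only [_root_.smul_apply, hgx, smul_eq_mul]
      simp [sq]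
    · simp [norm_smul, hg]

theorem dualityMap_mem (hJ : ∀ x, normalizedDualityMap X x = {J x}) (x : X) :
    J x ∈ normalizedDualityMap X x := by
  rw [hJ]; rfl

theorem eq_dualityMap_of_mem (hJ : ∀ x, normalizedDualityMap X x = {J x}) {x : X}
    {f : StrongDual ℝ X} (hf : f ∈ normalizedDualityMap X x) : f = J x := by
  rwa [hJ] at hf

theorem dualityMap_self (hJ : ∀ x, normalizedDualityMap X x = {J x}) (x : X) :
    J x x = ‖x‖ ^ 2 := (dualityMap_mem hJ x).1

theorem norm_dualityMap (hJ : ∀ x, normalizedDualityMap X x = {J x}) (x : X) :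
    ‖J x‖ = ‖x‖ :=
  (sq_eq_sq₀ (norm_nonneg _) (norm_nonneg _)).1 (dualityMap_mem hJ x).2

theorem abs_dualityMap_apply_le (hJ : ∀ x, normalizedDualityMap X x = {J x}) (x y : X) :
    |J x y| ≤ ‖x‖ * ‖y‖ := by
  simpa [norm_dualityMap hJ] using (J x).le_opNorm y

theorem dualityMap_zero (hJ : ∀ x, normalizedDualityMap X x = {J x}) : J 0 = 0 := by
  simpa using norm_dualityMap hJ 0

theorem dualityMap_neg (hJ : ∀ x, normalizedDualityMap X x = {J x}) (x : X) :
    J (-x) = -J x := by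
  refine (eq_dualityMap_of_mem hJ ⟨?_, ?_⟩).symm
  · simp [dualityMap_self hJ]
  · simp [norm_dualityMap hJ]

/-- The functional `2 J x` is a subgradient of `‖·‖²` at `x`. -/
theorem two_mul_dualityMap_sub_le (hJ : ∀ x, normalizedDualityMap X x = {J x}) (x y : X) :
    2 * J x (y - x) ≤ ‖y‖ ^ 2 - ‖x‖ ^ 2 := by
  have h := (abs_le.1 (abs_dualityMap_apply_le hJ x y)).2
  rw [map_sub, dualityMap_self hJ]
  nlinarith [sq_nonneg (‖x‖ - ‖y‖)]

/-- A single-valued normalized duality map is norm-to-weak* continuous. -/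
theorem tendsto_dualityMap_apply (hJ : ∀ x, normalizedDualityMap X x = {J x}) {ι : Type*}
    {l : Filter ι} {u : ι → X} {x : X} (hu : Tendsto u l (𝓝 x)) (h : X) :
    Tendsto (fun i => J (u i) h) l (𝓝 (J x h)) := by
  refine (tendsto_iff_ultrafilter _ _ _).2 fun U hU => ?_
  have huU : Tendsto u U (𝓝 x) := hu.mono_left hU
  have hb : ∀ h : X, ∀ᶠ i in (U : Filter ι), |J (u i) h| ≤ (‖x‖ + 1) * ‖h‖ := fun h =>
    (huU.norm.eventually_lt_const (lt_add_one _)).mono fun i hi =>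
      (abs_dualityMap_apply_le hJ _ _).trans (by gcongr)
  choose G hG using fun h => U.exists_tendsto_of_abs_le (hb h)
  let G' : X →ₗ[ℝ] ℝ :=
    { toFun := G
      map_add' := fun f g => tendsto_nhds_unique (hG (f + g)) (by simpa using (hG f).add (hG g))
      map_smul' := fun c f =>
        tendsto_nhds_unique (hG (c • f)) (by simpa using (hG f).const_mul c) }
  have hle : ∀ h, ‖G' h‖ ≤ ‖x‖ * ‖h‖ := fun h =>
    le_of_tendsto_of_tendsto (hG h).norm (huU.norm.mul_const _)
      (Eventually.of_forall fun i => abs_dualityMap_apply_le hJ _ _)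
  have hx : G' x = ‖x‖ ^ 2 := by
    have h0 : Tendsto (fun i => J (u i) (x - u i)) U (𝓝 0) := by
      refine squeeze_zero_norm (fun i => abs_dualityMap_apply_le hJ (u i) (x - u i)) ?_
      simpa using huU.norm.mul (huU.const_sub x).norm
    refine tendsto_nhds_unique (hG x) ?_
    simpa [dualityMap_self hJ] using (huU.norm.pow 2).add h0
  have hmem : G'.mkContinuous ‖x‖ hle ∈ normalizedDualityMap X x := by
    refine ⟨hx, ?_⟩
    have h1 := G'.mkContinuous_norm_le (norm_nonneg x) hle
    have h2 : ‖x‖ ^ 2 ≤ ‖G'.mkContinuous ‖x‖ hle‖ * ‖x‖ := by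
      have h3 := (G'.mkContinuous ‖x‖ hle).le_opNorm x
      rw [LinearMap.mkContinuous_apply, hx] at h3
      exact (le_abs_self _).trans h3
    refine le_antisymm (by gcongr) ?_
    nlinarith [norm_nonneg x, norm_nonneg (G'.mkContinuous ‖x‖ hle)]
  rw [← eq_dualityMap_of_mem hJ hmem]
  exact hG h

/-- Opial-type demiclosedness of `I - T` at a weak limit, from weak continuity of the duality
map. -/
theorem fixedPoint_of_weak_tendsto (hJ : ∀ x, normalizedDualityMap X x = {J x})
    {u : ℕ → X} {x : X} {T : X → X}
    (hw : ∀ v : X, Tendsto (fun n => J (u n - v) (x - T x)) atTop (𝓝 (J (x - v) (x - T x))))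
    {M : ℝ} (hM : ∀ n, ‖u n - x‖ ≤ M)
    (hT : ∀ n, ‖T (u n) - T x‖ ≤ ‖u n - x‖)
    (hu : Tendsto (fun n => ‖u n - T (u n)‖) atTop (𝓝 0)) : T x = x := by
  set h := x - T x with hh
  have h1 := hw x
  have h2 := hw (x - (1 / 2 : ℝ) • h)
  have hJh : J ((1 / 2 : ℝ) • h) ((1 / 2 : ℝ) • h) = ‖(1 / 2 : ℝ) • h‖ ^ 2 := dualityMap_self hJ _
  rw [map_smul, norm_smul, smul_eq_mul, Real.norm_of_nonneg (by norm_num)] at hJh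
  rw [sub_self, dualityMap_zero hJ] at h1
  rw [sub_sub_cancel] at h2
  have hlow : ∀ n, J (u n - x) h + J (u n - (x - (1 / 2 : ℝ) • h)) h ≤
      ‖u n - T (u n)‖ * (‖u n - T (u n)‖ + 2 * M) := by
    intro n
    have e1 := two_mul_dualityMap_sub_le hJ (u n - x) (u n - (x - (1 / 2 : ℝ) • h))
    have e2 := two_mul_dualityMap_sub_le hJ (u n - (x - (1 / 2 : ℝ) • h)) (u n - T x)
    have r1 : u n - (x - (1 / 2 : ℝ) • h) - (u n - x) = (1 / 2 : ℝ) • h := by abel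
    have r2 : u n - T x - (u n - (x - (1 / 2 : ℝ) • h)) = (1 / 2 : ℝ) • h := by
      rw [hh]; module
    rw [r1, map_smul, smul_eq_mul] at e1
    rw [r2, map_smul, smul_eq_mul] at e2
    have e3 : ‖u n - T x‖ ≤ ‖u n - T (u n)‖ + ‖u n - x‖ := by
      have := norm_sub_le_norm_sub_add_norm_sub (u n) (T (u n)) (T x)
      linarith [hT n]
    have e4 : ‖u n - T x‖ ^ 2 ≤ (‖u n - T (u n)‖ + ‖u n - x‖) ^ 2 := by gcongr
    nlinarith [hM n, norm_nonneg (u n - T (u n))]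
  have hlim := le_of_tendsto_of_tendsto (h1.add h2) (hu.mul (hu.add_const (2 * M)))
    (Eventually.of_forall hlow)
  have h0 : ‖h‖ = 0 := by
    simp only [_root_.zero_apply] at hlim
    nlinarith [norm_nonneg h]
  exact (sub_eq_zero.1 (norm_eq_zero.1 h0)).symm

end DualityMap

section UniformlySmooth

variable {X : Type*} [NormedAddCommGroup X] [NormedSpace ℝ X]

/-- In a uniformly smooth space, two functionals of norm at most one which almost attain their
norm at a common vector are close. -/
theorem IsUniformlySmoothSpace.exists_norm_sub_le (hX : IsUniformlySmoothSpace X) {ε : ℝ}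
    (hε : 0 < ε) : ∃ δ : ℝ, 0 < δ ∧ δ ≤ 1 ∧ ∀ (f g : StrongDual ℝ X) (x : X), ‖f‖ ≤ 1 → ‖g‖ ≤ 1 →
      x ≠ 0 → (1 - δ) * ‖x‖ ≤ f x → (1 - δ) * ‖x‖ ≤ g x → ‖f - g‖ ≤ ε := by
  obtain ⟨Λ, hΛ⟩ := hX
  have hev := Metric.tendstoUniformlyOn_iff.1 hΛ (ε / 4) (by positivity)
  obtain ⟨r, hr, hball⟩ := Metric.mem_nhdsWithin_iff.1 hev
  set t := r / 2 with ht
  have htpos : 0 < t := by positivity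
  have h1 := hball ⟨show t ∈ Metric.ball 0 r by
    simp only [Metric.mem_ball, dist_zero_right, Real.norm_eq_abs, abs_of_pos htpos]; linarith,
    htpos.ne'⟩
  have h2 := hball ⟨show -t ∈ Metric.ball 0 r by
    simp only [Metric.mem_ball, dist_zero_right, Real.norm_eq_abs, abs_neg, abs_of_pos htpos]
    linarith, (neg_lt_zero.2 htpos).ne⟩
  have hmod : ∀ x y : X, ‖x‖ = 1 → ‖y‖ = 1 → ‖x + t • y‖ + ‖x - t • y‖ ≤ 2 + ε / 2 * t := by
    intro x y hx hy
    have hxy : ((x, y) : X × X) ∈ Metric.sphere (0 : X) 1 ×ˢ Metric.sphere (0 : X) 1 := by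
      simp [hx, hy]
    have e1 := abs_lt.1 (by simpa only [Real.dist_eq] using h1 _ hxy)
    have e2 := abs_lt.1 (by simpa only [Real.dist_eq] using h2 _ hxy)
    simp only [hx, neg_smul, ← sub_eq_add_neg, div_neg] at e1 e2
    have e3 : (‖x + t • y‖ - 1) / t + (‖x - t • y‖ - 1) / t ≤ ε / 2 := by linarith [e1.1, e2.2]
    rw [← add_div, div_le_iff₀ htpos] at e3
    linarith
  set δ := min 1 (ε * t / 4)
  have hδ : 0 < δ := by positivity
  have hunit : ∀ (f g : StrongDual ℝ X) (x : X), ‖f‖ ≤ 1 → ‖g‖ ≤ 1 → ‖x‖ = 1 → 1 - δ ≤ f x →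
      1 - δ ≤ g x → ‖f - g‖ ≤ ε := by
    intro f g x hf hg hx hfx hgx
    have key : ∀ y : X, ‖y‖ = 1 → (f - g) y ≤ ε := by
      intro y hy
      have a1 := (le_abs_self _).trans (f.le_of_opNorm_le hf (x + t • y))
      have a2 := (le_abs_self _).trans (g.le_of_opNorm_le hg (x - t • y))
      simp only [map_add, map_sub, map_smul, smul_eq_mul, one_mul] at a1 a2
      have a3 := hmod x y hx hy
      have a4 : δ ≤ ε * t / 4 := min_le_right _ _
      rw [_root_.sub_apply]
      refine le_of_mul_le_mul_left ?_ htpos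
      linarith
    refine ContinuousLinearMap.opNorm_le_of_unit_norm hε.le fun y hy => abs_le.2 ⟨?_, key y hy⟩
    have := key (-y) (by rwa [norm_neg])
    rw [map_neg] at this
    linarith
  refine ⟨δ, hδ, min_le_left _ _, fun f g x hf hg hx hfx hgx => ?_⟩
  have hxpos := norm_pos_iff.2 hx
  refine hunit f g (‖x‖⁻¹ • x) hf hg (norm_smul_inv_norm (𝕜 := ℝ) hx) ?_ ?_
  · rw [map_smul, smul_eq_mul, inv_mul_eq_div, le_div_iff₀ hxpos]; exact hfx
  · rw [map_smul, smul_eq_mul, inv_mul_eq_div, le_div_iff₀ hxpos]; exact hgx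

theorem IsUniformlySmoothSpace.exists_dualityMap (hX : IsUniformlySmoothSpace X) :
    ∃ J : X → StrongDual ℝ X, ∀ x, normalizedDualityMap X x = {J x} := by
  choose J hJ using normalizedDualityMap_nonempty (X := X)
  refine ⟨J, fun x => subset_antisymm (fun f hf => ?_) (singleton_subset_iff.2 (hJ x))⟩
  have hnorm : ∀ g ∈ normalizedDualityMap X x, ‖g‖ = ‖x‖ := fun g hg =>
    (sq_eq_sq₀ (norm_nonneg _) (norm_nonneg _)).1 hg.2
  rcases eq_or_ne x 0 with rfl | hx
  · have h1 := hnorm f hf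
    have h2 := hnorm _ (hJ 0)
    rw [norm_zero, norm_eq_zero] at h1 h2
    rw [mem_singleton_iff, h1, h2]
  have hpos := norm_pos_iff.2 hx
  have hle : ‖‖x‖⁻¹ • f - ‖x‖⁻¹ • J x‖ = 0 := by
    refine le_antisymm (le_of_forall_pos_le_add fun ε hε => ?_) (norm_nonneg _)
    obtain ⟨δ, hδ, -, h⟩ := hX.exists_norm_sub_le hε
    have aux : ∀ g ∈ normalizedDualityMap X x, ‖‖x‖⁻¹ • g‖ ≤ 1 ∧
        (1 - δ) * ‖x‖ ≤ (‖x‖⁻¹ • g) x := fun g hg => by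
      constructor
      · rw [norm_smul, hnorm g hg, norm_inv, norm_norm, inv_mul_cancel₀ hpos.ne']
      · rw [_root_.smul_apply, hg.1, smul_eq_mul, sq, inv_mul_cancel_left₀ hpos.ne']
        nlinarith
    rw [zero_add]
    exact h _ _ x (aux f hf).1 (aux _ (hJ x)).1 hx (aux f hf).2 (aux _ (hJ x)).2
  exact smul_right_injective _ (inv_ne_zero hpos.ne') (sub_eq_zero.1 (norm_eq_zero.1 hle))

end UniformlySmooth

section Reflexivity

/-- Helly's lemma for two functionals. -/
theorem exists_mem_closedBall_approx_bidual {E : Type*} [NormedAddCommGroup E] [NormedSpace ℝ E]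
    {G : StrongDual ℝ (StrongDual ℝ E)} (hG : ‖G‖ ≤ 1) (f g : StrongDual ℝ E) {ε : ℝ}
    (hε : 0 < ε) : ∃ x : E, ‖x‖ ≤ 1 ∧ |f x - G f| < ε ∧ |g x - G g| < ε := by
  set A : Set (ℝ × ℝ) := (f.prod g) '' Metric.closedBall 0 1
  have hA : Convex ℝ A := (convex_closedBall 0 1).linear_image (f.prod g).toLinearMap
  by_cases hmem : (G f, G g) ∈ closure A
  · obtain ⟨_, ⟨x, hx, rfl⟩, hd⟩ := Metric.mem_closure_iff.1 hmem ε hε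
    rw [dist_comm, Prod.dist_eq, max_lt_iff] at hd
    exact ⟨x, by simpa using hx, hd.1, hd.2⟩
  · exfalso
    obtain ⟨Φ, r, hΦ, hr⟩ := geometric_hahn_banach_closed_point hA.closure isClosed_closure hmem
    set h : StrongDual ℝ E := Φ.comp (f.prod g)
    have hx : ∀ x : E, ‖x‖ ≤ 1 → h x < r := fun x hx =>
      hΦ _ (subset_closure ⟨x, by simpa using hx, rfl⟩)
    have hr0 : 0 < r := by simpa using hx 0 (by simp)
    have hnorm : ‖h‖ ≤ r := by
      refine ContinuousLinearMap.opNorm_le_of_unit_norm hr0.le fun x h1 =>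
        abs_le.2 ⟨?_, (hx x h1.le).le⟩
      have := hx (-x) (by rw [norm_neg]; exact h1.le)
      rw [map_neg] at this
      linarith
    have hsplit : ∀ a b : ℝ, Φ (a, b) = a * Φ (1, 0) + b * Φ (0, 1) := fun a b => by
      rw [← smul_eq_mul, ← smul_eq_mul, ← map_smul, ← map_smul, ← map_add]
      simp
    have hh : h = Φ (1, 0) • f + Φ (0, 1) • g := by
      ext x
      simp only [h, ContinuousLinearMap.comp_apply, ContinuousLinearMap.prod_apply,
        _root_.add_apply, _root_.smul_apply, smul_eq_mul]
      rw [hsplit]; ring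
    have hGh : G h = Φ (G f, G g) := by
      rw [hsplit, hh, map_add, map_smul, map_smul, smul_eq_mul, smul_eq_mul]; ring
    have h1 := (le_abs_self _).trans (G.le_of_opNorm_le hG h)
    rw [hGh] at h1
    linarith

theorem ContinuousLinearMap.exists_norm_le_one_lt_apply {E : Type*} [NormedAddCommGroup E]
    [NormedSpace ℝ E] (f : StrongDual ℝ E) {r : ℝ} (hr : r < ‖f‖) :
    ∃ x : E, ‖x‖ ≤ 1 ∧ r < f x := by
  by_contra! h
  have hr0 : 0 ≤ r := by simpa using h 0 (by simp)
  refine hr.not_ge (ContinuousLinearMap.opNorm_le_of_unit_norm hr0 fun x h1 =>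
    abs_le.2 ⟨?_, h x h1.le⟩)
  have := h (-x) (by rw [norm_neg]; exact h1.le)
  rw [map_neg] at this
  linarith

theorem isClosed_range_inclusionInDoubleDual {E : Type*} [NormedAddCommGroup E] [NormedSpace ℝ E]
    [CompleteSpace E] : IsClosed (range (NormedSpace.inclusionInDoubleDual ℝ E)) :=
  (NormedSpace.inclusionInDoubleDualLi (E := E) ℝ).isometry.isUniformInducing
    |>.isComplete_range.isClosed

theorem surjective_of_approx_unit {E F : Type*} [NormedAddCommGroup E] [NormedSpace ℝ E]
    [NormedAddCommGroup F] [NormedSpace ℝ F] {A : E →L[ℝ] F} (hA : IsClosed (range A))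
    (h : ∀ y, ‖y‖ = 1 → ∀ ε > 0, ∃ x, ‖A x - y‖ ≤ ε) : Function.Surjective A := by
  intro y
  rcases eq_or_ne y 0 with rfl | hy
  · exact ⟨0, map_zero _⟩
  obtain ⟨x, hx⟩ : ‖y‖⁻¹ • y ∈ range A := by
    refine hA.closure_subset (Metric.mem_closure_iff.2 fun ε hε => ?_)
    obtain ⟨x, hx⟩ := h (‖y‖⁻¹ • y) (norm_smul_inv_norm (𝕜 := ℝ) hy) (ε / 2) (half_pos hε)
    refine ⟨_, mem_range_self x, ?_⟩
    rw [dist_comm, dist_eq_norm]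
    linarith
  refine ⟨‖y‖ • x, ?_⟩
  rw [map_smul, hx, smul_inv_smul₀ (norm_ne_zero_iff.2 hy)]

theorem UniformConvexSpace.exists_approx_bidual {E : Type*} [NormedAddCommGroup E]
    [NormedSpace ℝ E] [UniformConvexSpace E] {G : StrongDual ℝ (StrongDual ℝ E)} (hG : ‖G‖ = 1)
    {ε : ℝ} (hε : 0 < ε) : ∃ x, ‖NormedSpace.inclusionInDoubleDual ℝ E x - G‖ ≤ ε := by
  obtain ⟨δ, hδ, hclose⟩ := exists_forall_closed_ball_dist_add_le_two_sub E (half_pos hε)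
  obtain ⟨f, hf1, hf⟩ := G.exists_norm_le_one_lt_apply (r := 1 - δ / 2) (by linarith)
  have hη : 0 < G f - (1 - δ / 2) := by linarith
  have hdiam : ∀ u v : E, ‖u‖ ≤ 1 → ‖v‖ ≤ 1 → 1 - δ / 2 < f u → 1 - δ / 2 < f v →
      ‖u - v‖ ≤ ε / 2 := by
    intro u v hu hv hfu hfv
    by_contra! hlt
    have h1 := hclose hu hv hlt.le
    have := (le_abs_self _).trans (f.le_of_opNorm_le hf1 (u + v))
    rw [map_add] at this
    linarith
  have hsel : ∀ g : StrongDual ℝ E, ∃ x : E, ‖x‖ ≤ 1 ∧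
      1 - δ / 2 < f x ∧ |g x - G g| < ε / 2 := fun g => by
    obtain ⟨x, hx, hxf, hxg⟩ := exists_mem_closedBall_approx_bidual hG.le f g
      (lt_min hη (half_pos hε))
    have := (abs_lt.1 (hxf.trans_le (min_le_left _ _))).1
    exact ⟨x, hx, by linarith, hxg.trans_le (min_le_right _ _)⟩
  obtain ⟨x₀, hx₀, hfx₀, -⟩ := hsel f
  refine ⟨x₀, ContinuousLinearMap.opNorm_le_of_unit_norm hε.le fun g hg => ?_⟩
  obtain ⟨x, hx, hfx, hgx⟩ := hsel g
  have h1 := g.le_of_opNorm_le hg.le (x₀ - x)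
  have h2 := hdiam x₀ x hx₀ hx hfx₀ hfx
  rw [map_sub, one_mul, Real.norm_eq_abs] at h1
  rw [_root_.sub_apply, NormedSpace.dual_def, Real.norm_eq_abs]
  have h3 := abs_sub_le (g x₀) (g x) (G g)
  linarith

/-- The Milman-Pettis theorem. -/
theorem UniformConvexSpace.isReflexiveSpace {E : Type*} [NormedAddCommGroup E] [NormedSpace ℝ E]
    [CompleteSpace E] [UniformConvexSpace E] : IsReflexiveSpace E := by
  have h := @surjective_of_approx_unit E (StrongDual ℝ (StrongDual ℝ E)) _ _ _ _
    (NormedSpace.inclusionInDoubleDual ℝ E)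
  have h' := h isClosed_range_inclusionInDoubleDual
  exact h' fun _ hG _ hε => exists_approx_bidual hG hε

variable {X : Type*} [NormedAddCommGroup X] [NormedSpace ℝ X]

theorem IsUniformlySmoothSpace.uniformConvexSpace_strongDual (hX : IsUniformlySmoothSpace X) :
    UniformConvexSpace (StrongDual ℝ X) := by
  refine ⟨fun ε hε => ?_⟩
  obtain ⟨δ, hδ, hδ1, hclose⟩ := hX.exists_norm_sub_le (half_pos hε)
  refine ⟨δ, hδ, fun u hu v hv huv => ?_⟩
  by_contra! h1
  obtain ⟨x, hx1, hx⟩ := ContinuousLinearMap.exists_norm_le_one_lt_apply _ h1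
  rw [_root_.add_apply] at hx
  have hux := (le_abs_self _).trans (u.le_of_opNorm_le hu.le x)
  have hvx := (le_abs_self _).trans (v.le_of_opNorm_le hv.le x)
  have hx0 : x ≠ 0 := by
    rintro rfl
    simp only [map_zero] at hx
    linarith
  have := hclose u v x hu.le hv.le hx0 (by nlinarith) (by nlinarith)
  linarith

theorem isReflexiveSpace_of_strongDual [CompleteSpace X]
    (h : IsReflexiveSpace (StrongDual ℝ X)) : IsReflexiveSpace X := by
  have hclosed : IsClosed ((NormedSpace.inclusionInDoubleDual ℝ X).range :
      Set (StrongDual ℝ (StrongDual ℝ X))) := by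
    rw [LinearMap.coe_range]
    exact isClosed_range_inclusionInDoubleDual
  intro G
  by_contra hG
  have hG' : G ∉ ((NormedSpace.inclusionInDoubleDual ℝ X).range :
      Set (StrongDual ℝ (StrongDual ℝ X))) := hG
  obtain ⟨Ψ, r, hΨ, hr⟩ := geometric_hahn_banach_closed_point (Submodule.convex _) hclosed hG'
  obtain ⟨f, rfl⟩ := h Ψ
  have hlt : ∀ x : X, f x < r := fun x => hΨ _ ⟨x, rfl⟩
  have hf : f = 0 := by
    ext x
    by_contra hne
    have := hlt ((r / f x) • x)
    rw [map_smul, smul_eq_mul, div_mul_cancel₀ _ hne] at this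
    exact this.false
  have := hlt 0
  simp only [hf, map_zero, _root_.zero_apply] at hr this
  exact (hr.trans this).false

theorem IsUniformlySmoothSpace.isReflexiveSpace [CompleteSpace X]
    (hX : IsUniformlySmoothSpace X) : IsReflexiveSpace X :=
  have := hX.uniformConvexSpace_strongDual
  isReflexiveSpace_of_strongDual UniformConvexSpace.isReflexiveSpace

end Reflexivity

section AsymptoticRadius

variable {X : Type*} [NormedAddCommGroup X] {ι : Type*}

/-- `r z` is the limit of `‖u i - z‖` along the ultrafilter `U`. -/
def IsAsymptoticRadius (U : Ultrafilter ι) (u : ι → X) (r : X → ℝ) : Prop :=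
  ∀ z, Tendsto (fun i => ‖u i - z‖) U (𝓝 (r z))

theorem exists_isAsymptoticRadius (U : Ultrafilter ι) {u : ι → X} {M : ℝ} (hu : ∀ i, ‖u i‖ ≤ M) :
    ∃ r, IsAsymptoticRadius U u r := by
  choose r hr using fun z : X => U.exists_tendsto_of_abs_le (g := fun i => ‖u i - z‖)
    (M := M + ‖z‖) (Eventually.of_forall fun i => by
      rw [abs_norm]
      exact (norm_sub_le _ _).trans (by gcongr; exact hu i))
  exact ⟨r, hr⟩

namespace IsAsymptoticRadius

variable {U : Ultrafilter ι} {u : ι → X} {r : X → ℝ}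

theorem nonneg (hr : IsAsymptoticRadius U u r) (z : X) : 0 ≤ r z :=
  ge_of_tendsto (hr z) (Eventually.of_forall fun _ => norm_nonneg _)

theorem norm_le (hr : IsAsymptoticRadius U u r) {M : ℝ} (hu : ∀ i, ‖u i‖ ≤ M) (z : X) :
    ‖z‖ ≤ r z + M :=
  ge_of_tendsto ((hr z).add_const M) (Eventually.of_forall fun i => by
    have := norm_le_norm_sub_add z (u i)
    rw [norm_sub_rev] at this
    linarith [hu i])

theorem le_add (hr : IsAsymptoticRadius U u r) (x y : X) : r x ≤ r y + dist x y :=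
  le_of_tendsto_of_tendsto (hr x) ((hr y).add_const _) (Eventually.of_forall fun i => by
    have := norm_sub_le_norm_sub_add_norm_sub (u i) y x
    rw [dist_comm, dist_eq_norm]
    exact this)

theorem isClosed_setOf_le (hr : IsAsymptoticRadius U u r) (c : ℝ) : IsClosed {z | r z ≤ c} :=
  isClosed_le (LipschitzWith.of_le_add hr.le_add).continuous continuous_const

theorem apply_le (hr : IsAsymptoticRadius U u r) {T : X → X}
    (hu : Tendsto (fun i => ‖u i - T (u i)‖) U (𝓝 0)) {z : X}
    (hT : ∀ i, ‖T (u i) - T z‖ ≤ ‖u i - z‖) : r (T z) ≤ r z := by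
  have h := le_of_tendsto_of_tendsto (hr (T z)) (hu.add (hr z)) (Eventually.of_forall fun i =>
    (norm_sub_le_norm_sub_add_norm_sub (u i) (T (u i)) (T z)).trans (add_le_add_right (hT i) _))
  rwa [zero_add] at h

variable [NormedSpace ℝ X]

theorem convex_setOf_le (hr : IsAsymptoticRadius U u r) (c : ℝ) : Convex ℝ {z | r z ≤ c} := by
  intro x hx y hy a b ha hb hab
  have h := le_of_tendsto_of_tendsto (hr (a • x + b • y))
    (((hr x).const_mul a).add ((hr y).const_mul b)) (Eventually.of_forall fun i => by
      have e : u i - (a • x + b • y) = a • (u i - x) + b • (u i - y) := by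
        obtain rfl : b = 1 - a := by linarith
        module
      simp only [e]
      refine (norm_add_le _ _).trans_eq ?_
      rw [norm_smul, norm_smul, Real.norm_of_nonneg ha, Real.norm_of_nonneg hb])
  rw [mem_ofPred_eq] at hx hy ⊢
  calc r (a • x + b • y) ≤ a * r x + b * r y := h
    _ ≤ a * c + b * c := by gcongr
    _ = c := by rw [← add_mul, hab, one_mul]

/-- In a reflexive space, the asymptotic radius attains its minimum on closed convex sets. -/
theorem exists_forall_le (hr : IsAsymptoticRadius U u r) (hX : IsReflexiveSpace X) {M : ℝ}
    (hu : ∀ i, ‖u i‖ ≤ M) {C : Set X} (hC : IsClosed C) (hconv : Convex ℝ C) (hne : C.Nonempty) :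
    ∃ x ∈ C, ∀ z ∈ C, r x ≤ r z := by
  have hbdd : BddBelow (r '' C) := ⟨0, forall_mem_image.2 fun z _ => hr.nonneg z⟩
  have hex : ∀ n : ℕ, ∃ z ∈ C, r z < sInf (r '' C) + 1 / ((n : ℝ) + 1) := fun n => by
    obtain ⟨_, ⟨z, hz, rfl⟩, h⟩ := exists_lt_of_csInf_lt (hne.image r)
      (lt_add_of_pos_right (sInf (r '' C)) (Nat.one_div_pos_of_nat (α := ℝ) (n := n)))
    exact ⟨z, hz, h⟩
  choose z hz hzr using hex
  have hzb : ∀ n, ‖z n‖ ≤ sInf (r '' C) + 1 + M := fun n => by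
    have h1 := hr.norm_le hu (z n)
    have h2 : 1 / ((n : ℝ) + 1) ≤ 1 := by
      rw [div_le_one (by positivity)]
      linarith [n.cast_nonneg (α := ℝ)]
    linarith [hzr n]
  obtain ⟨x, hx⟩ := hX.exists_weak_ultralimit (Ultrafilter.of (atTop : Filter ℕ)) hzb
  refine ⟨x, hconv.mem_of_weak_tendsto hC (Eventually.of_forall hz) hx, fun y hy => ?_⟩
  refine le_of_forall_pos_le_add fun ε hε => ?_
  have hlim := (tendsto_one_div_add_atTop_nhds_zero_nat (𝕜 := ℝ)).eventually_lt_const hε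
  have hmem : x ∈ {w | r w ≤ r y + ε} :=
    (hr.convex_setOf_le _).mem_of_weak_tendsto (hr.isClosed_setOf_le _)
      (Ultrafilter.of_le _ (hlim.mono fun n hn => by
        have := csInf_le hbdd (mem_image_of_mem r hy)
        rw [mem_ofPred_eq]
        linarith [hzr n])) hx
  exact hmem

end IsAsymptoticRadius

variable [NormedSpace ℝ X]

/-- A weakly null family in a uniformly smooth space whose asymptotic radius is constant on the
segments from the origin to its members is asymptotically null. -/
theorem IsUniformlySmoothSpace.eq_zero_of_tendsto_norm_sub_smul (hX : IsUniformlySmoothSpace X)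
    {l : Filter ι} [l.NeBot] {v : ι → X} {c : ℝ}
    (hv : ∀ m, ∀ s ∈ Icc (0 : ℝ) 1, Tendsto (fun i => ‖v i - s • v m‖) l (𝓝 c))
    (hw : ∀ f : StrongDual ℝ X, Tendsto (fun i => f (v i)) l (𝓝 0)) : c = 0 := by
  obtain ⟨i₀⟩ := l.nonempty_of_neBot
  have hc0 : 0 ≤ c := ge_of_tendsto (hv i₀ 0 (by simp)) (Eventually.of_forall fun _ => norm_nonneg _)
  have h0 : Tendsto (fun i => ‖v i‖) l (𝓝 c) := by simpa using hv i₀ 0 (by simp)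
  by_contra hne
  have hc : 0 < c := lt_of_le_of_ne hc0 (Ne.symm hne)
  obtain ⟨δ, hδ, hδ1, hclose⟩ := hX.exists_norm_sub_le (show (0 : ℝ) < 1 / 4 by norm_num)
  obtain ⟨η, hη⟩ : ∃ η, η = δ * c / 10 := ⟨_, rfl⟩
  have hη0 : 0 < η := by rw [hη]; positivity
  have hηc : η ≤ c / 10 := by rw [hη]; nlinarith
  obtain ⟨m, hm1, hm2⟩ := ((h0.eventually_lt_const (lt_add_of_pos_right c hη0)).and
    (h0.eventually_const_lt (sub_lt_self c hη0))).exists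
  obtain ⟨f, hf1, hf⟩ := exists_dual_vector'' ℝ (v m)
  obtain ⟨s, hs⟩ : ∃ s, s = η / (2 * c) := ⟨_, rfl⟩
  have hs0 : 0 < s := by rw [hs]; positivity
  have hs1 : s ≤ 1 := by rw [hs, div_le_one (by positivity)]; linarith
  have hsm : s * ‖v m‖ ≤ η := by
    calc s * ‖v m‖ ≤ s * (2 * c) := by gcongr; linarith
      _ = η := by rw [hs]; field_simp
  have hsη : 0 < s * η := by positivity
  have hsη1 : s * η ≤ η := mul_le_of_le_one_left hη0.le hs1
  obtain ⟨i, hi1, hi2, hi3, hi4⟩ := ((h0.eventually_lt_const (lt_add_of_pos_right c hsη)).and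
    (((hv m s ⟨hs0.le, hs1⟩).eventually_const_lt (sub_lt_self c hsη)).and
    (((hv m 1 (by simp)).eventually_lt_const (lt_add_of_pos_right c hη0)).and
    ((hw f).eventually (Metric.ball_mem_nhds 0 hη0))))).exists
  rw [dist_zero_right, Real.norm_eq_abs, abs_lt] at hi4
  rw [one_smul] at hi3
  obtain ⟨g, hg1, hg⟩ := exists_dual_vector'' ℝ (v i - s • v m)
  simp only [map_sub, map_smul, smul_eq_mul, RCLike.ofReal_real_eq_id, id] at hg hf
  have hgi := (le_abs_self _).trans (g.le_of_opNorm_le hg1 (v i))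
  have hgm := (neg_le_abs _).trans (g.le_of_opNorm_le hg1 (v m))
  rw [one_mul] at hgi hgm
  have a1 : g (v m) ≤ 2 * η := le_of_mul_le_mul_left (by linarith) hs0
  have a2 : c - 2 * η ≤ g (v i) := by nlinarith
  have hbound : (1 - δ) * ‖v m - v i‖ ≤ c - 4 * η := by
    rw [norm_sub_rev]
    calc (1 - δ) * ‖v i - v m‖ ≤ (1 - δ) * (c + η) := by gcongr
      _ ≤ c - 4 * η := by nlinarith
  have b1 : c - 2 * η ≤ f (v m - v i) := by rw [map_sub]; linarith
  have b2 : c - 4 * η ≤ (-g) (v m - v i) := by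
    rw [_root_.neg_apply, map_sub]; linarith
  have hne' : v m - v i ≠ 0 := by
    intro h
    rw [h, map_zero] at b1
    linarith
  have hfg := hclose f (-g) (v m - v i) hf1 (by rwa [norm_neg]) hne' (by linarith) (by linarith)
  have h1 := (le_abs_self _).trans ((f - -g).le_of_opNorm_le hfg (v i))
  rw [sub_neg_eq_add, _root_.add_apply] at h1
  linarith

end AsymptoticRadius

section FixedPoints

variable {X : Type*} [NormedAddCommGroup X] [NormedSpace ℝ X] [CompleteSpace X]

/-- The implicit viscosity iteration is well defined. -/
theorem existsUnique_implicit_viscosity {C : Set X} (hC : IsClosed C) (hconv : Convex ℝ C)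
    (hne : C.Nonempty) {T : X → X} (hTmaps : MapsTo T C C)
    (hT : ∀ x ∈ C, ∀ y ∈ C, ‖T x - T y‖ ≤ ‖x - y‖) {Φ : X → X} (hΦmaps : MapsTo Φ C C)
    {ρ : ℝ} (hρ0 : 0 ≤ ρ) (hρ1 : ρ < 1) (hΦ : ∀ x ∈ C, ∀ y ∈ C, ‖Φ x - Φ y‖ ≤ ρ * ‖x - y‖)
    {t : ℝ} (ht : t ∈ Ioo (0 : ℝ) 1) :
    ∃! y : X, y ∈ C ∧ y = T (t • Φ y + (1 - t) • y) := by
  have ht1 : 0 < 1 - t := by linarith [ht.2]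
  have hmem : ∀ y ∈ C, t • Φ y + (1 - t) • y ∈ C := fun y hy =>
    hconv (hΦmaps hy) hy ht.1.le ht1.le (by ring)
  refine existsUnique_fixedPoint_of_contraction_on hC hne (g := fun y => T (t • Φ y + (1 - t) • y))
    (k := t * ρ + (1 - t)) (fun y hy => hTmaps (hmem y hy)) (by nlinarith [ht.1])
    (by nlinarith [ht.1]) fun x hx y hy => ?_
  refine (hT _ (hmem x hx) _ (hmem y hy)).trans ?_
  have e : t • Φ x + (1 - t) • x - (t • Φ y + (1 - t) • y) =
      t • (Φ x - Φ y) + (1 - t) • (x - y) := by module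
  rw [e]
  refine (norm_add_le _ _).trans ?_
  rw [norm_smul, norm_smul, Real.norm_of_nonneg ht.1.le, Real.norm_of_nonneg ht1.le]
  have := hΦ x hx y hy
  nlinarith [ht.1]

theorem exists_approx_fixedPoint {K : Set X} (hK : IsClosed K) (hconv : Convex ℝ K)
    (hne : K.Nonempty) {M : ℝ} (hM : ∀ x ∈ K, ‖x‖ ≤ M) {T : X → X} (hTmaps : MapsTo T K K)
    (hT : ∀ x ∈ K, ∀ y ∈ K, ‖T x - T y‖ ≤ ‖x - y‖) :
    ∃ u : ℕ → X, (∀ n, u n ∈ K) ∧ Tendsto (fun n => ‖u n - T (u n)‖) atTop (𝓝 0) := by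
  obtain ⟨a, ha⟩ := hne
  have hex : ∀ n : ℕ, ∃ x ∈ K, ‖x - T x‖ ≤ 1 / ((n : ℝ) + 1 + 1) * (2 * M) := fun n => by
    have ht : 1 / ((n : ℝ) + 1 + 1) ∈ Ioo (0 : ℝ) 1 := by
      have := n.cast_nonneg (α := ℝ)
      exact ⟨by positivity, by rw [div_lt_one (by positivity)]; linarith⟩
    obtain ⟨y, ⟨hy, hyT⟩, -⟩ := existsUnique_implicit_viscosity hK hconv ⟨a, ha⟩ hTmaps hT
      (Φ := fun _ => a) (fun _ _ => ha) le_rfl zero_lt_one (by simp) ht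
    set t := 1 / ((n : ℝ) + 1 + 1)
    refine ⟨t • a + (1 - t) • y, hconv ha hy ht.1.le (by linarith [ht.2]) (by ring), ?_⟩
    rw [← hyT]
    have e : t • a + (1 - t) • y - y = t • (a - y) := by module
    rw [e, norm_smul, Real.norm_of_nonneg ht.1.le]
    exact mul_le_mul_of_nonneg_left (by linarith [norm_sub_le a y, hM a ha, hM y hy]) ht.1.le
  choose u hu huT using hex
  refine ⟨u, hu, squeeze_zero (fun _ => norm_nonneg _) huT ?_⟩
  have := ((tendsto_one_div_add_atTop_nhds_zero_nat (𝕜 := ℝ)).comp (tendsto_add_atTop_nat 1)).mul_const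
    (2 * M)
  simpa [Function.comp_def] using this

/-- Uniformly smooth spaces have the fixed point property for nonexpansive mappings. -/
theorem IsUniformlySmoothSpace.exists_fixedPoint (hX : IsUniformlySmoothSpace X) {K : Set X}
    (hK : IsClosed K) (hconv : Convex ℝ K) (hne : K.Nonempty) {M : ℝ} (hM : ∀ x ∈ K, ‖x‖ ≤ M)
    {T : X → X} (hTmaps : MapsTo T K K) (hT : ∀ x ∈ K, ∀ y ∈ K, ‖T x - T y‖ ≤ ‖x - y‖) :
    ∃ x ∈ K, T x = x := by
  have hrefl := hX.isReflexiveSpace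
  obtain ⟨A, hAK, hA⟩ := zorn_superset_nonempty
    {A : Set X | A ⊆ K ∧ A.Nonempty ∧ IsClosed A ∧ Convex ℝ A ∧ MapsTo T A A}
    (fun c hc hchain hcne => by
      refine ⟨⋂₀ c, ⟨?_, ?_, ?_, ?_, ?_⟩, fun s hs => sInter_subset_of_mem hs⟩
      · obtain ⟨B, hB⟩ := hcne
        exact (sInter_subset_of_mem hB).trans (hc hB).1
      · exact hrefl.nonempty_sInter_of_isChain hchain hcne (M := M) fun B hB =>
          ⟨(hc hB).2.1, (hc hB).2.2.1, (hc hB).2.2.2.1, fun x hx => hM x ((hc hB).1 hx)⟩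
      · exact isClosed_sInter fun B hB => (hc hB).2.2.1
      · exact convex_sInter fun B hB => (hc hB).2.2.2.1
      · exact fun x hx B hB => (hc hB).2.2.2.2 (hx B hB)) K
    ⟨subset_rfl, hne, hK, hconv, hTmaps⟩
  obtain ⟨-, hAne, hAcl, hAconv, hAT⟩ := hA.prop
  have hTA : ∀ x ∈ A, ∀ y ∈ A, ‖T x - T y‖ ≤ ‖x - y‖ := fun x hx y hy => hT x (hAK hx) y (hAK hy)
  obtain ⟨u, huA, hu⟩ := exists_approx_fixedPoint hAcl hAconv hAne (fun x hx => hM x (hAK hx)) hAT hTA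
  let U : Ultrafilter ℕ := Ultrafilter.of atTop
  have huU : Tendsto (fun n => ‖u n - T (u n)‖) U (𝓝 0) := hu.mono_left (Ultrafilter.of_le _)
  have hub : ∀ n, ‖u n‖ ≤ M := fun n => hM _ (hAK (huA n))
  obtain ⟨r, hr⟩ := exists_isAsymptoticRadius U hub
  have hle : ∀ z ∈ A, ∀ w ∈ A, r z ≤ r w := by
    intro z hz w hw
    have hsub : A ⊆ A ∩ {x | r x ≤ r w} := hA.le_of_le (y := A ∩ {x | r x ≤ r w})
      ⟨inter_subset_left.trans hAK, ⟨w, hw, le_refl (r w)⟩, hAcl.inter (hr.isClosed_setOf_le _),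
        hAconv.inter (hr.convex_setOf_le _), fun x hx => ⟨hAT hx.1,
          (hr.apply_le huU fun i => hTA _ (huA i) _ hx.1).trans hx.2⟩⟩ inter_subset_left
    exact (hsub hz).2
  obtain ⟨x, hx⟩ := hrefl.exists_weak_ultralimit U hub
  have hxA : x ∈ A := hAconv.mem_of_weak_tendsto hAcl (Eventually.of_forall huA) hx
  have hconst : ∀ z ∈ A, Tendsto (fun n => ‖u n - z‖) U (𝓝 (r x)) := fun z hz => by
    rw [(hle x hxA z hz).antisymm (hle z hz x hxA)]
    exact hr z
  have hzero : r x = 0 := by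
    refine hX.eq_zero_of_tendsto_norm_sub_smul (l := (U : Filter ℕ)) (v := fun n => u n - x)
      (fun m s hs => ?_) fun f => ?_
    · have hmem : (1 - s) • x + s • u m ∈ A :=
        hAconv hxA (huA m) (by linarith [hs.2]) hs.1 (by ring)
      refine (hconst _ hmem).congr fun n => ?_
      congr 1
      module
    · simpa using (hx f).sub_const (f x)
  have hlim : ∀ z ∈ A, Tendsto u U (𝓝 z) := fun z hz =>
    tendsto_iff_norm_sub_tendsto_zero.2 (hzero ▸ hconst z hz)
  exact ⟨x, hAK hxA, tendsto_nhds_unique (hlim _ (hAT hxA)) (hlim _ hxA)⟩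

end FixedPoints

section Viscosity

variable {X : Type*} [NormedAddCommGroup X] [NormedSpace ℝ X]

/-- Strong subsequential convergence of asymptotically fixed viscosity sequences when the duality
map is weakly continuous. -/
theorem exists_tendsto_subseq_of_weaklyContinuous {J : X → StrongDual ℝ X}
    (hJ : ∀ x, normalizedDualityMap X x = {J x}) (hX : IsReflexiveSpace X)
    (hw : HasWeaklyContinuousDualityMap X)
    {C : Set X} (hC : IsClosed C) (hconv : Convex ℝ C) {T : X → X}
    (hT : ∀ x ∈ C, ∀ y ∈ C, ‖T x - T y‖ ≤ ‖x - y‖) {Φ : X → X} {ρ : ℝ} (hρ1 : ρ < 1)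
    {u : ℕ → X} (huC : ∀ n, u n ∈ C) {M : ℝ} (hM : ∀ n, ‖u n‖ ≤ M)
    (hu : Tendsto (fun n => ‖u n - T (u n)‖) atTop (𝓝 0))
    (hΦ : ∀ p ∈ {x ∈ C | T x = x}, ∀ n, (1 - ρ) * ‖u n - p‖ ^ 2 ≤ J (u n - p) (Φ p - p)) :
    ∃ p ∈ {x ∈ C | T x = x}, ∃ φ : ℕ → ℕ, StrictMono φ ∧ Tendsto (u ∘ φ) atTop (𝓝 p) := by
  obtain ⟨J', hJ', hwc⟩ := hw
  obtain rfl : J' = J := funext fun x => by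
    simpa using (hJ' x).symm.trans (hJ x)
  obtain ⟨p, φ, hφ, hp⟩ := hX.exists_weak_tendsto_subseq hM
  have hpC : p ∈ C := hconv.mem_of_weak_tendsto hC (Eventually.of_forall fun n => huC (φ n)) hp
  have hlim : ∀ v h : X, Tendsto (fun n => J' (u (φ n) - v) h) atTop (𝓝 (J' (p - v) h)) := by
    intro v h
    have h1 : Tendsto (fun n => toWeakSpace ℝ X (u (φ n) - v)) atTop
        (𝓝 (toWeakSpace ℝ X (p - v))) := by
      refine (WeakBilin.tendsto_iff_forall_eval_tendsto (topDualPairing ℝ X).flip ?_).2 fun f => ?_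
      · intro x y hxy
        by_contra hne
        obtain ⟨f, hf⟩ := geometric_hahn_banach_point_point hne
        exact hf.ne (LinearMap.congr_fun hxy f)
      · have h2 := (hp f).sub_const (f v)
        simp only [← map_sub] at h2
        exact h2
    exact tendsto_iff_forall_eval_tendsto_topDualPairing.1 (hwc _ _ h1) h
  have hpT : T p = p := fixedPoint_of_weak_tendsto hJ (M := M + ‖p‖) (fun v => hlim v _)
    (fun n => (norm_sub_le _ _).trans (by gcongr; exact hM _))
    (fun n => hT _ (huC _) _ hpC) (hu.comp hφ.tendsto_atTop)
  refine ⟨p, ⟨hpC, hpT⟩, φ, hφ, ?_⟩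
  have h0 := hlim p (Φ p - p)
  rw [sub_self, dualityMap_zero hJ, _root_.zero_apply] at h0
  have h1 : Tendsto (fun n => (1 - ρ) * ‖u (φ n) - p‖ ^ 2) atTop (𝓝 0) :=
    squeeze_zero (fun n => mul_nonneg (by linarith) (sq_nonneg _)) (fun n => hΦ p ⟨hpC, hpT⟩ _) h0
  have h2 := (h1.const_mul (1 - ρ)⁻¹).sqrt
  rw [tendsto_iff_norm_sub_tendsto_zero]
  simpa [inv_mul_cancel_left₀ (sub_pos.2 hρ1).ne', Real.sqrt_sq] using h2

/-- Strong subsequential convergence of asymptotically fixed viscosity sequences in uniformly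
smooth spaces. -/
theorem exists_tendsto_subseq_of_uniformlySmooth [CompleteSpace X] {J : X → StrongDual ℝ X}
    (hJ : ∀ x, normalizedDualityMap X x = {J x}) (hX : IsUniformlySmoothSpace X)
    {C : Set X} (hC : IsClosed C) (hconv : Convex ℝ C) {T : X → X} (hTmaps : MapsTo T C C)
    (hT : ∀ x ∈ C, ∀ y ∈ C, ‖T x - T y‖ ≤ ‖x - y‖) {Φ : X → X} (hΦmaps : MapsTo Φ C C)
    {ρ : ℝ} (hρ1 : ρ < 1)
    {u : ℕ → X} (huC : ∀ n, u n ∈ C) {M : ℝ} (hM : ∀ n, ‖u n‖ ≤ M)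
    (hu : Tendsto (fun n => ‖u n - T (u n)‖) atTop (𝓝 0))
    (hΦ : ∀ p ∈ {x ∈ C | T x = x}, ∀ n, (1 - ρ) * ‖u n - p‖ ^ 2 ≤ J (u n - p) (Φ p - p)) :
    ∃ p ∈ {x ∈ C | T x = x}, ∃ φ : ℕ → ℕ, StrictMono φ ∧ Tendsto (u ∘ φ) atTop (𝓝 p) := by
  let U : Ultrafilter ℕ := Ultrafilter.of atTop
  have hUle : (U : Filter ℕ) ≤ atTop := Ultrafilter.of_le _
  have huU := hu.mono_left hUle
  obtain ⟨r, hr⟩ := exists_isAsymptoticRadius U hM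
  obtain ⟨x₀, hx₀, hmin⟩ := hr.exists_forall_le hX.isReflexiveSpace hM hC hconv ⟨u 0, huC 0⟩
  obtain ⟨p, ⟨hpC, hpr⟩, hpT⟩ := hX.exists_fixedPoint (K := C ∩ {z | r z ≤ r x₀})
    (hC.inter (hr.isClosed_setOf_le _)) (hconv.inter (hr.convex_setOf_le _)) ⟨x₀, hx₀, le_refl (r x₀)⟩
    (M := r x₀ + M) (fun x hx => (hr.norm_le hM x).trans (by gcongr; exact hx.2))
    (T := T) (fun x hx => ⟨hTmaps hx.1,
      (hr.apply_le huU fun i => hT _ (huC i) _ hx.1).trans hx.2⟩)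
    (fun x hx y hy => hT x hx.1 y hy.1)
  replace hmin : ∀ z ∈ C, r p ≤ r z := fun z hz => le_trans hpr (hmin z hz)
  have hzero : r p = 0 := by
    by_contra hne
    have hc : 0 < r p := lt_of_le_of_ne (hr.nonneg p) (Ne.symm hne)
    have hρ : 0 < 1 - ρ := sub_pos.2 hρ1
    set h := Φ p - p with hh
    obtain ⟨ε, hεdef⟩ : ∃ ε, ε = (1 - ρ) * r p / (4 * (‖h‖ + 1)) := ⟨_, rfl⟩
    have hε : 0 < ε := by rw [hεdef]; positivity
    obtain ⟨δ, hδ, hδ1, hclose⟩ := hX.exists_norm_sub_le hε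
    obtain ⟨s, hsdef⟩ : ∃ s, s = min 1 (δ * r p / (8 * (‖h‖ + 1))) := ⟨_, rfl⟩
    have hs : 0 < s := by rw [hsdef]; positivity
    have hs1 : s ≤ 1 := hsdef ▸ min_le_left _ _
    have hsh : s * ‖h‖ ≤ δ * r p / 8 := by
      have h1 : s ≤ δ * r p / (8 * (‖h‖ + 1)) := hsdef ▸ min_le_right _ _
      rw [le_div_iff₀ (by positivity)] at h1
      nlinarith
    have hmem : p + s • h ∈ C := by
      have := hconv hpC (hΦmaps hpC) (sub_nonneg.2 hs1) hs.le (sub_add_cancel 1 s)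
      convert this using 1
      rw [hh]; module
    have hlow : r p < r (p + s • h) + s * ε := by
      have := hmin _ hmem
      have : 0 < s * ε := by positivity
      linarith
    have hdiff : ∀ᶠ i in (U : Filter ℕ), ‖u i - p‖ < ‖u i - (p + s • h)‖ + s * ε :=
      (hr p).eventually_lt ((hr (p + s • h)).add_const _) hlow
    obtain ⟨i, hi1, hi2⟩ := (hdiff.and ((hr p).eventually_const_lt (half_lt_self hc))).exists
    obtain ⟨g, hg1, hg⟩ := exists_dual_vector'' ℝ (u i - (p + s • h))
    rw [← sub_sub] at hg hi1
    have hipos : 0 < ‖u i - p‖ := by linarith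
    have hne0 : u i - p ≠ 0 := norm_pos_iff.1 hipos
    rw [map_sub, map_smul, smul_eq_mul, RCLike.ofReal_real_eq_id, id] at hg
    have hgp := (le_abs_self _).trans (g.le_of_opNorm_le hg1 (u i - p))
    have hgh := (neg_le_abs _).trans (g.le_of_opNorm_le hg1 h)
    rw [one_mul] at hgp hgh
    have hgε : g h ≤ ε := le_of_mul_le_mul_left (by linarith) hs
    have htri : ‖u i - p‖ - s * ‖h‖ ≤ ‖u i - p - s • h‖ := by
      have := norm_sub_norm_le (u i - p) (s • h)
      rwa [norm_smul, Real.norm_of_nonneg hs.le] at this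
    have hfg := hclose (‖u i - p‖⁻¹ • J (u i - p)) g (u i - p)
      (by rw [norm_smul, norm_inv, norm_norm, norm_dualityMap hJ, inv_mul_cancel₀ hipos.ne']) hg1 hne0
      (by
        rw [_root_.smul_apply, dualityMap_self hJ, smul_eq_mul, sq, inv_mul_cancel_left₀ hipos.ne']
        nlinarith)
      (by nlinarith)
    have h1 := (le_abs_self _).trans ((‖u i - p‖⁻¹ • J (u i - p) - g).le_of_opNorm_le hfg h)
    rw [_root_.sub_apply, _root_.smul_apply, smul_eq_mul] at h1
    have h2 : ‖u i - p‖⁻¹ * J (u i - p) h ≤ ε * (‖h‖ + 1) := by linarith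
    have h3 : ε * (‖h‖ + 1) = (1 - ρ) * r p / 4 := by rw [hεdef]; field_simp
    rw [h3, inv_mul_le_iff₀ hipos] at h2
    have h4 := (hΦ p ⟨hpC, hpT⟩ i).trans h2
    have h5 : (1 - ρ) * ‖u i - p‖ ≤ (1 - ρ) * r p / 4 :=
      le_of_mul_le_mul_left (by linarith) hipos
    nlinarith
  have hlim : Tendsto u U (𝓝 p) := tendsto_iff_norm_sub_tendsto_zero.2 (hzero ▸ hr p)
  have hcl : MapClusterPt p atTop u := hlim.mapClusterPt.mono hUle
  obtain ⟨φ, hφ, hφp⟩ := hcl.tendsto_subseq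
  exact ⟨p, ⟨hpC, hpT⟩, φ, hφ, hφp⟩

theorem SolvesVI.eq {J : X → StrongDual ℝ X} (hJ : ∀ x, normalizedDualityMap X x = {J x})
    {Φ : X → X} {C F : Set X} (hFC : F ⊆ C) {ρ : ℝ} (hρ1 : ρ < 1)
    (hΦ : ∀ x ∈ C, ∀ y ∈ C, ‖Φ x - Φ y‖ ≤ ρ * ‖x - y‖) {p q : X} (hp : SolvesVI J Φ F p)
    (hq : SolvesVI J Φ F q) : p = q := by
  have h1 := hp.2 q hq.1
  have h2 := hq.2 p hp.1
  rw [← neg_sub q p, dualityMap_neg hJ, _root_.neg_apply] at h2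
  have h3 := (abs_le.1 (abs_dualityMap_apply_le hJ (q - p) (Φ q - Φ p))).2
  have h4 := hΦ q (hFC hq.1) p (hFC hp.1)
  have h5 := dualityMap_self hJ (q - p)
  simp only [map_sub] at h1 h2 h3 h5
  have h6 : (1 - ρ) * ‖q - p‖ ^ 2 ≤ 0 := by nlinarith [norm_nonneg (q - p)]
  have h7 : ‖q - p‖ ^ 2 = 0 := by nlinarith [sq_nonneg ‖q - p‖]
  exact (sub_eq_zero.1 (norm_eq_zero.1 (pow_eq_zero_iff two_ne_zero |>.1 h7))).symm

/-- One step of the implicit viscosity scheme: with `x = T y` and `y = t Φ x + (1 - t) x`, the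
vector `Φ x - x` has nonnegative pairing with `J (y - p)` for each fixed point `p` of `T`. -/
theorem dualityMap_viscosity_nonneg {J : X → StrongDual ℝ X}
    (hJ : ∀ x, normalizedDualityMap X x = {J x}) {t : ℝ} (ht : 0 < t) {x y z p : X}
    (hy : y = t • z + (1 - t) • x) (hxy : ‖x - p‖ ≤ ‖y - p‖) : 0 ≤ J (y - p) (z - x) := by
  have h1 := (abs_le.1 (abs_dualityMap_apply_le hJ (y - p) (x - p))).2
  have h2 := dualityMap_self hJ (y - p)
  have e : y - p = t • (z - x) + (x - p) := by rw [hy]; module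
  have h3 : J (y - p) (y - p) = t * J (y - p) (z - x) + J (y - p) (x - p) := by
    refine (congrArg (J (y - p)) e).trans ?_
    rw [map_add, map_smul, smul_eq_mul]
  have h4 : 0 ≤ t * J (y - p) (z - x) := by nlinarith [norm_nonneg (y - p)]
  exact nonneg_of_mul_nonneg_right h4 ht

end Viscosity

section ViscosityConvergence

variable {X : Type*} [NormedAddCommGroup X] [NormedSpace ℝ X] {J : X → StrongDual ℝ X}

theorem viscosity_sq_le (hJ : ∀ x, normalizedDualityMap X x = {J x}) {Φ : X → X} {ρ : ℝ}
    (hρ0 : 0 ≤ ρ) {t : ℝ} (ht : t ∈ Ioo (0 : ℝ) 1) {x y p : X} (hy : y = t • Φ x + (1 - t) • x)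
    (hxy : ‖x - p‖ ≤ ‖y - p‖) (hΦ : ‖Φ x - Φ p‖ ≤ ρ * ‖x - p‖) :
    (1 - ρ) * ‖y - p‖ ^ 2 ≤ J (y - p) (Φ p - p) := by
  have h1 := dualityMap_viscosity_nonneg hJ ht.1 hy hxy
  have h2 := (abs_le.1 (abs_dualityMap_apply_le hJ (y - p) (Φ x - Φ p))).2
  have e : y - p = (Φ x - Φ p) + (Φ p - p) - (1 - t) • (Φ x - x) := by rw [hy]; module
  have h3 : J (y - p) (y - p) =
      J (y - p) (Φ x - Φ p) + J (y - p) (Φ p - p) - (1 - t) * J (y - p) (Φ x - x) := by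
    refine (congrArg (J (y - p)) e).trans ?_
    rw [map_sub, map_add, map_smul, smul_eq_mul]
  rw [dualityMap_self hJ] at h3
  have h4 : 0 ≤ (1 - t) * J (y - p) (Φ x - x) := mul_nonneg (by linarith [ht.2]) h1
  have h5 : ‖y - p‖ * ‖Φ x - Φ p‖ ≤ ‖y - p‖ * (ρ * ‖y - p‖) := by
    gcongr
    exact hΦ.trans (by gcongr)
  nlinarith

theorem tendsto_dualityMap_apply_of_tendsto (hJ : ∀ x, normalizedDualityMap X x = {J x})
    {ι : Type*} {l : Filter ι} {u w : ι → X} {x z : X} (hu : Tendsto u l (𝓝 x))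
    (hw : Tendsto w l (𝓝 z)) : Tendsto (fun i => J (u i) (w i)) l (𝓝 (J x z)) := by
  have h0 : Tendsto (fun i => J (u i) (w i - z)) l (𝓝 0) := by
    refine squeeze_zero_norm (fun i => abs_dualityMap_apply_le hJ (u i) (w i - z)) ?_
    simpa using hu.norm.mul (hw.sub_const z).norm
  simpa using (tendsto_dualityMap_apply hJ hu z).add h0

/-- Convergence of the implicit viscosity scheme along subsequences, given strong subsequential
convergence of asymptotically fixed viscosity sequences. -/
theorem exists_solvesVI_tendsto_subseq (hJ : ∀ x, normalizedDualityMap X x = {J x})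
    {C : Set X} (hconv : Convex ℝ C) {T : X → X}
    (hT : ∀ x ∈ C, ∀ y ∈ C, ‖T x - T y‖ ≤ ‖x - y‖) (hF : {x ∈ C | T x = x}.Nonempty)
    {Φ : X → X} (hΦmaps : MapsTo Φ C C) {ρ : ℝ} (hρ0 : 0 ≤ ρ) (hρ1 : ρ < 1)
    (hΦ : ∀ x ∈ C, ∀ y ∈ C, ‖Φ x - Φ y‖ ≤ ρ * ‖x - y‖)
    (hsub : ∀ (u : ℕ → X) (M : ℝ), (∀ n, u n ∈ C) → (∀ n, ‖u n‖ ≤ M) →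
      Tendsto (fun n => ‖u n - T (u n)‖) atTop (𝓝 0) →
      (∀ p ∈ {x ∈ C | T x = x}, ∀ n, (1 - ρ) * ‖u n - p‖ ^ 2 ≤ J (u n - p) (Φ p - p)) →
      ∃ p ∈ {x ∈ C | T x = x}, ∃ φ : ℕ → ℕ, StrictMono φ ∧ Tendsto (u ∘ φ) atTop (𝓝 p))
    {s : ℕ → ℝ} (hs : ∀ n, s n ∈ Ioo (0 : ℝ) 1) (hs0 : Tendsto s atTop (𝓝 0)) {x : ℕ → X}
    (hxC : ∀ n, x n ∈ C) (hx : ∀ n, x n = T (s n • Φ (x n) + (1 - s n) • x n)) :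
    ∃ q, SolvesVI J Φ {x ∈ C | T x = x} q ∧
      ∃ φ : ℕ → ℕ, StrictMono φ ∧ Tendsto (x ∘ φ) atTop (𝓝 q) := by
  obtain ⟨y, hy⟩ : ∃ y : ℕ → X, ∀ n, y n = s n • Φ (x n) + (1 - s n) • x n := ⟨_, fun _ => rfl⟩
  have hyC : ∀ n, y n ∈ C := fun n => by
    rw [hy]
    exact hconv (hΦmaps (hxC n)) (hxC n) (hs n).1.le (by linarith [(hs n).2]) (by ring)
  have hTy : ∀ n, T (y n) = x n := fun n => by rw [hy, ← hx]
  have hxy : ∀ p ∈ {x ∈ C | T x = x}, ∀ n, ‖x n - p‖ ≤ ‖y n - p‖ := fun p hp n => by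
    have := hT _ (hyC n) _ hp.1
    rwa [hTy, hp.2] at this
  have hsq : ∀ p ∈ {x ∈ C | T x = x}, ∀ n,
      (1 - ρ) * ‖y n - p‖ ^ 2 ≤ J (y n - p) (Φ p - p) := fun p hp n =>
    viscosity_sq_le hJ hρ0 (hs n) (hy n) (hxy p hp n) (hΦ _ (hxC n) _ hp.1)
  obtain ⟨p, hp⟩ := hF
  have hρ : 0 < 1 - ρ := sub_pos.2 hρ1
  obtain ⟨B, hB⟩ : ∃ B, B = ‖Φ p - p‖ / (1 - ρ) := ⟨_, rfl⟩
  have hB0 : 0 ≤ B := by rw [hB]; positivity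
  have hyB : ∀ n, ‖y n - p‖ ≤ B := fun n => by
    rcases (norm_nonneg (y n - p)).eq_or_lt with h0 | hpos
    · rwa [← h0]
    rw [hB, le_div_iff₀ hρ]
    have h1 := (hsq p hp n).trans (abs_le.1 (abs_dualityMap_apply_le hJ _ _)).2
    refine le_of_mul_le_mul_left ?_ hpos
    linarith
  have hyx : ∀ n, ‖y n - x n‖ ≤ s n * (B + (‖Φ p - p‖ + B)) := fun n => by
    have e : y n - x n = s n • ((Φ (x n) - Φ p) + ((Φ p - p) - (x n - p))) := by
      rw [hy]; module
    rw [e, norm_smul, Real.norm_of_nonneg (hs n).1.le]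
    have h1 := (hxy p hp n).trans (hyB n)
    have h2 : ‖Φ (x n) - Φ p‖ ≤ B := by
      have := hΦ _ (hxC n) _ hp.1
      nlinarith [norm_nonneg (x n - p)]
    refine mul_le_mul_of_nonneg_left ?_ (hs n).1.le
    refine (norm_add_le _ _).trans (add_le_add h2 ((norm_sub_le _ _).trans ?_))
    gcongr
  have hyx0 : Tendsto (fun n => ‖y n - x n‖) atTop (𝓝 0) :=
    squeeze_zero (fun _ => norm_nonneg _) hyx (by simpa using hs0.mul_const _)
  obtain ⟨q, hq, φ, hφ, hyq⟩ := hsub y (B + ‖p‖) hyC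
    (fun n => by linarith [norm_le_norm_sub_add (y n) p, hyB n])
    (by simpa only [hTy] using hyx0) hsq
  have hxq : Tendsto (x ∘ φ) atTop (𝓝 q) := by
    have h1 := hyq.sub (tendsto_zero_iff_norm_tendsto_zero.2 (hyx0.comp hφ.tendsto_atTop))
    simpa [Function.comp_def] using h1
  have hΦq : Tendsto (fun n => Φ (x (φ n))) atTop (𝓝 (Φ q)) := by
    rw [tendsto_iff_norm_sub_tendsto_zero] at hxq ⊢
    exact squeeze_zero (fun _ => norm_nonneg _) (fun n => hΦ _ (hxC _) _ hq.1)
      (by simpa using hxq.const_mul ρ)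
  refine ⟨q, ⟨hq, fun z hz => ?_⟩, φ, hφ, hxq⟩
  have hlim := tendsto_dualityMap_apply_of_tendsto hJ (hyq.sub_const z) (hΦq.sub hxq)
  have hnn := ge_of_tendsto hlim (Eventually.of_forall fun n =>
    dualityMap_viscosity_nonneg hJ (hs (φ n)).1 (hy (φ n)) (hxy z hz (φ n)))
  rw [← neg_sub q z, dualityMap_neg hJ, _root_.neg_apply]
  linarith

end ViscosityConvergence

theorem mainTheorem1 {X : Type*} [NormedAddCommGroup X] [NormedSpace ℝ X] [CompleteSpace X]
    (hX : (IsReflexiveSpace X ∧ HasWeaklyContinuousDualityMap X) ∨ IsUniformlySmoothSpace X)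
    (C : Set X) (hCclosed : IsClosed C) (hCconvex : Convex ℝ C)
    (T : X → X) (hTmaps : MapsTo T C C)
    (hT : ∀ x ∈ C, ∀ y ∈ C, ‖T x - T y‖ ≤ ‖x - y‖)
    (hF : {x ∈ C | T x = x}.Nonempty)
    (Φ : X → X) (hΦmaps : MapsTo Φ C C)
    (ρ : ℝ) (hρ0 : 0 ≤ ρ) (hρ1 : ρ < 1)
    (hΦ : ∀ x ∈ C, ∀ y ∈ C, ‖Φ x - Φ y‖ ≤ ρ * ‖x - y‖) :
    (∀ t ∈ Ioo (0 : ℝ) 1, ∃! y : X, y ∈ C ∧ y = T (t • Φ y + (1 - t) • y)) ∧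
    ∃ J : X → StrongDual ℝ X, (∀ x, normalizedDualityMap X x = {J x}) ∧
      ∃ q : X, SolvesVI J Φ {x ∈ C | T x = x} q ∧
        (∀ q' : X, SolvesVI J Φ {x ∈ C | T x = x} q' → q' = q) ∧
        ∀ x : ℝ → X,
          (∀ t ∈ Ioo (0 : ℝ) 1, x t ∈ C ∧ x t = T (t • Φ (x t) + (1 - t) • x t)) →
          Tendsto x (𝓝[>] 0) (𝓝 q) := by
  have hfix : ∀ t ∈ Ioo (0 : ℝ) 1, ∃! y : X, y ∈ C ∧ y = T (t • Φ y + (1 - t) • y) :=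
    fun t ht => existsUnique_implicit_viscosity hCclosed hCconvex (hF.mono fun _ h => h.1) hTmaps hT
      hΦmaps hρ0 hρ1 hΦ ht
  refine ⟨hfix, ?_⟩
  obtain ⟨J, hJ⟩ : ∃ J : X → StrongDual ℝ X, ∀ x, normalizedDualityMap X x = {J x} :=
    hX.elim (fun h => h.2.imp fun _ h' => h'.1) fun h => h.exists_dualityMap
  have hmain := fun (s : ℕ → ℝ) hs hs0 (x : ℕ → X) hxC hx =>
    exists_solvesVI_tendsto_subseq (s := s) (x := x) hJ hCconvex hT hF hΦmaps hρ0 hρ1 hΦ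
      (fun u M huC hM hu hsq => hX.elim
        (fun h => exists_tendsto_subseq_of_weaklyContinuous hJ h.1 h.2 hCclosed hCconvex hT hρ1
          huC hM hu hsq)
        fun h => exists_tendsto_subseq_of_uniformlySmooth hJ h hCclosed hCconvex hTmaps hT hΦmaps
          hρ1 huC hM hu hsq) hs hs0 hxC hx
  have huniq : ∀ p q, SolvesVI J Φ {x ∈ C | T x = x} p → SolvesVI J Φ {x ∈ C | T x = x} q →
      p = q := fun p q hp hq => SolvesVI.eq hJ (fun _ h => h.1) hρ1 hΦ hp hq
  have hseq : ∀ n : ℕ, 1 / ((n : ℝ) + 1 + 1) ∈ Ioo (0 : ℝ) 1 := fun n => by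
    have := n.cast_nonneg (α := ℝ)
    exact ⟨by positivity, by rw [div_lt_one (by positivity)]; linarith⟩
  choose x₀ hx₀ using fun n => (hfix _ (hseq n)).exists
  obtain ⟨q, hq, -⟩ := hmain (fun n => 1 / ((n : ℝ) + 1 + 1)) hseq (by
    simpa [Function.comp_def] using
      (tendsto_one_div_add_atTop_nhds_zero_nat (𝕜 := ℝ)).comp (tendsto_add_atTop_nat 1))
    x₀ (fun n => (hx₀ n).1) fun n => (hx₀ n).2
  refine ⟨J, hJ, q, hq, fun q' hq' => huniq _ _ hq' hq, fun x hx => ?_⟩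
  refine tendsto_of_subseq_tendsto fun s hs => ?_
  obtain ⟨N, hN⟩ := eventually_atTop.1
    (hs.eventually (Ioo_mem_nhdsGT (zero_lt_one (α := ℝ))))
  have hs' : ∀ n, s (n + N) ∈ Ioo (0 : ℝ) 1 := fun n => hN _ (Nat.le_add_left _ _)
  obtain ⟨q', hq', φ, -, hφ⟩ := hmain (fun n => s (n + N)) hs'
    ((tendsto_nhdsWithin_iff.1 hs).1.comp (tendsto_add_atTop_nat N)) (fun n => x (s (n + N)))
    (fun n => (hx _ (hs' n)).1) fun n => (hx _ (hs' n)).2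
  exact ⟨fun n => φ n + N, huniq _ _ hq' hq ▸ hφ⟩
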